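/- Let $p$ be a prime and let $\mathbb{F}_{p^2}$ be a field with $p^2$ elements. Call a function $F\colon \mathbb{F}_{p^2}\to\mathbb{F}_{p^2}$ planar if for every nonzero $\alpha\in\mathbb{F}_{p^2}$ the map $x\mapsto F(x+\alpha)-F(x)-F(\alpha)$ is a permutation of $\mathbb{F}_{p^2}$. For a non-negative integer $i$ let $s_p(i)$ be the sum of the digits of $i$ in base $p$. For a nonzero function $F$, let $\sum_{i=0}^{p^2-1}a_iX^i$ be the unique polynomial of degree at most $p^2-1$ over $\mathbb{F}_{p^2}$ whose evaluation map is $F$; the algebraic degree of $F$ is $d_{\mathsf{alg}}(F)=\max\{s_p(i)\mid a_i\neq 0\}$. If $F$ is a monomial function, that is, $F(x)=x^d$ for some non-negative integer $d$, and $F$ is planar on $\mathbb{F}_{p^2}$, then $d_{\mathsf{alg}}(F)=2$. -/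

import Mathlib

/-- The sum of the digits of `e` in base `p`. -/
def digitSum (p e : ℕ) : ℕ := (Nat.digits p e).sum

/-- A function `F : K → K` is planar if `x ↦ F (x + α) - F x - F α` is a permutation of `K`
for every nonzero `α`. -/
def IsPlanar {K : Type*} [Field K] (F : K → K) : Prop :=
  ∀ α : K, α ≠ 0 → Function.Bijective (fun x : K => F (x + α) - F x - F α)

/-- A monomial function on `K` is the evaluation map of some monomial `X ^ d`. -/
def IsMonomialFunction {K : Type*} [Field K] (F : K → K) : Prop :=
  ∃ d : ℕ, F = fun x : K => x ^ d

open Classical in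
/-- The unique polynomial of degree less than `Fintype.card K` whose evaluation map is `F`. -/
noncomputable def interpolatingPolynomial {K : Type*} [Field K] [Fintype K] (F : K → K) :
    Polynomial K :=
  Lagrange.interpolate Finset.univ id F

/-- The algebraic degree of `F : K → K`, for `K` a finite field of characteristic `p`: the largest
base-`p` digit sum of an exponent that occurs with nonzero coefficient in the interpolating
polynomial of `F`. (The value for the zero function is `0` by convention.) -/
noncomputable def algebraicDegree (p : ℕ) {K : Type*} [Field K] [Fintype K] (F : K → K) : ℕ :=
  (interpolatingPolynomial F).support.sup (digitSum p)

/-! If `x ^ n` is planar on a field of order q, then the moments `∑ (x - y) ^ s * (x ^ n - y ^ n) ^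
k` vanish for s > 0 and k < q - 1. Expanded binomially, only terms whose two exponents are positive
multiples of q - 1 survive; s and k are chosen so that the survivors cannot cancel. On the prime
subfield this gives n ≡ 2 mod p - 1 (`modEq_two`). So for n = a + bp the digit sum a + b is 2, p + 1
or 2(p - 1). The last means n = q - 1, against `gcd_dvd_two`; the value p + 1 is excluded by a
second moment (`false_of_digits`). -/

open Finset in
/-- The sum of the `m`-th powers of the elements of a finite field. -/
theorem FiniteField.sum_pow_eq {K : Type*} [Field K] [Fintype K] (m : ℕ) :
    ∑ x : K, x ^ m = if 0 < m ∧ Fintype.card K - 1 ∣ m then -1 else 0 := by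
  classical
  rcases Nat.eq_zero_or_pos m with rfl | hm
  · simp
  · have h0 : ∑ x : K, x ^ m = ∑ x : Kˣ, (x ^ m : K) := by
      rw [← Finset.sum_erase (f := fun x : K => x ^ m) univ (a := 0) (zero_pow hm.ne'),
        Finset.sum_subtype (univ.erase (0 : K)) (p := fun x => x ≠ 0) (by simp)]
      exact (Fintype.sum_equiv unitsEquivNeZero _ _ fun x => rfl).symm
    rw [h0, FiniteField.sum_pow_units]
    simp [hm]

/-! ### Elementary constraints and vanishing moments -/

/-- For a planar monomial `x ^ n` over a finite field, the maps `x ↦ (x + α) ^ n - x ^ n` are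
injective. -/
def InjectiveDifferences (K : Type*) [Field K] (n : ℕ) : Prop :=
  ∀ α : K, α ≠ 0 → Function.Injective (fun x : K => (x + α) ^ n - x ^ n)

theorem IsPlanar.injectiveDifferences {K : Type*} [Field K] {n : ℕ}
    (h : IsPlanar fun x : K => x ^ n) : InjectiveDifferences K n := by
  intro α hα x y hxy
  refine (h α hα).1 ?_
  simp only at hxy ⊢
  rw [hxy]

theorem IsPlanar.two_ne_zero {K : Type*} [Field K] {F : K → K} (h : IsPlanar F) :
    (2 : K) ≠ 0 := by
  intro h2
  have h11 : (1 + 1 : K) = 0 := by rw [one_add_one_eq_two, h2]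
  have := @(h 1 one_ne_zero).1 0 1 (by
    simp only [zero_add, h11]
    linear_combination (F 1 - F 0) * h2)
  exact zero_ne_one this

namespace InjectiveDifferences

variable {K : Type*} [Field K] {n : ℕ}

theorem pos (h : InjectiveDifferences K n) : 0 < n := by
  rcases Nat.eq_zero_or_pos n with rfl | hn
  · exact absurd (@h 1 one_ne_zero 0 1 (by simp)) zero_ne_one
  · exact hn

theorem even (h : InjectiveDifferences K n) : Even n := by
  by_contra hodd
  rw [Nat.not_even_iff_odd] at hodd
  have := @h 1 one_ne_zero 0 (-1) (by simp [hodd.neg_one_pow, h.pos.ne'])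
  exact one_ne_zero (neg_eq_zero.mp this.symm)

theorem of_algebraMap {k : Type*} [Field k] [Algebra k K] (h : InjectiveDifferences K n) :
    InjectiveDifferences k n := by
  intro α hα x y hxy
  have hα' : algebraMap k K α ≠ 0 := by simpa using hα
  refine (algebraMap k K).injective (h _ hα' ?_)
  simpa using congrArg (algebraMap k K) hxy

theorem sq_eq_one_of_pow_eq_one (h : InjectiveDifferences K n) (h2 : (2 : K) ≠ 0) {y : K}
    (hy : y ^ n = 1) : y ^ 2 = 1 := by
  by_cases h1 : y = 1
  · simp [h1]
  have hy1 : y - 1 ≠ 0 := sub_ne_zero.mpr h1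
  -- The two points solve x + 1 = yx and x + 1 = -x; the difference is zero at both.
  have key := @h 1 one_ne_zero (1 / (y - 1)) (-1 / 2) (by
    have e1 : 1 / (y - 1) + 1 = y * (1 / (y - 1)) := by field_simp; ring
    have e2 : (-1 / 2 + 1 : K) = -(-1 / 2) := by field_simp; ring
    simp only [e1, e2, mul_pow, hy, h.even.neg_pow]
    ring)
  have : y = -1 := by
    field_simp at key
    linear_combination key
  simp [this]

variable [Fintype K]

/-- The unit group is cyclic, so it has an element of order the gcd; its `n`-th power is 1, hence so
is its square. -/
theorem gcd_dvd_two (h : InjectiveDifferences K n) (h2 : (2 : K) ≠ 0) :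
    n.gcd (Fintype.card K - 1) ∣ 2 := by
  classical
  obtain ⟨g, hg⟩ := IsCyclic.exists_generator (α := Kˣ)
  have hog : orderOf g = Fintype.card K - 1 := by
    rw [orderOf_eq_card_of_forall_mem_zpowers hg, Nat.card_eq_fintype_card, Fintype.card_units]
  have hq : 0 < Fintype.card K - 1 := Nat.sub_pos_of_lt Fintype.one_lt_card
  obtain ⟨c, hc⟩ := Nat.gcd_dvd_right n (Fintype.card K - 1)
  obtain ⟨e, he⟩ := Nat.gcd_dvd_left n (Fintype.card K - 1)
  set d := n.gcd (Fintype.card K - 1)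
  have hy : ((g ^ c : Kˣ) : K) ^ n = 1 := by
    rw [← Units.val_pow_eq_pow_val, ← pow_mul, he, ← mul_assoc, mul_comm c d, ← hc, ← hog,
      pow_mul, pow_orderOf_eq_one, one_pow, Units.val_one]
  have hy2 := h.sq_eq_one_of_pow_eq_one h2 hy
  rw [← Units.val_pow_eq_pow_val, Units.val_eq_one, ← pow_mul, ← orderOf_dvd_iff_pow_eq_one, hog,
    hc, mul_comm c 2] at hy2
  have hc0 : 0 < c := Nat.pos_of_ne_zero fun h0 => by simp [h0] at hc; omega
  exact Nat.dvd_of_mul_dvd_mul_right hc0 hy2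

/-- Put x = y + α. For α ≠ 0 the difference map permutes `K`, leaving a power sum of exponent `k`,
which is zero; `s > 0` removes α = 0. -/
theorem sum_mul_pow_eq_zero (h : InjectiveDifferences K n) {s k : ℕ} (hs : 0 < s)
    (hk : k < Fintype.card K - 1) :
    ∑ y : K, ∑ x : K, (x - y) ^ s * (x ^ n - y ^ n) ^ k = 0 := by
  have e1 : ∀ y : K, ∑ x : K, (x - y) ^ s * (x ^ n - y ^ n) ^ k =
      ∑ α : K, α ^ s * ((y + α) ^ n - y ^ n) ^ k := fun y =>
    (Fintype.sum_equiv (Equiv.addLeft y) _ _ fun α => by simp).symm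
  simp_rw [e1]
  rw [Finset.sum_comm]
  refine Finset.sum_eq_zero fun α _ => ?_
  rcases eq_or_ne α 0 with rfl | hα
  · simp [hs.ne']
  · rw [← Finset.mul_sum, (Finite.injective_iff_bijective.mp (h α hα)).sum_comp (fun c => c ^ k),
      FiniteField.sum_pow_lt_card_sub_one K k hk, mul_zero]

/-- The vanishing moments of a planar monomial, expanded by the binomial theorem. -/
theorem sum_choose_mul_choose_eq_zero (h : InjectiveDifferences K n) {s k : ℕ} (hs : 0 < s)
    (hk : k < Fintype.card K - 1) :
    ∑ j ∈ Finset.range (k + 1), ∑ i ∈ Finset.range (s + 1),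
      (((-1) ^ (i + s) * s.choose i : K) * ((-1) ^ (j + k) * k.choose j)) *
        ((∑ x : K, x ^ (i + n * j)) * ∑ y : K, y ^ (s - i + n * (k - j))) = 0 := by
  rw [← h.sum_mul_pow_eq_zero hs hk]
  have e : ∀ y x : K, (x - y) ^ s * (x ^ n - y ^ n) ^ k =
      ∑ j ∈ Finset.range (k + 1), ∑ i ∈ Finset.range (s + 1),
        (((-1) ^ (i + s) * s.choose i : K) * ((-1) ^ (j + k) * k.choose j)) *
          (x ^ (i + n * j) * y ^ (s - i + n * (k - j))) := by
    intro y x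
    rw [sub_pow, sub_pow, Finset.sum_mul_sum, Finset.sum_comm]
    refine Finset.sum_congr rfl fun j _ => Finset.sum_congr rfl fun i _ => ?_
    rw [pow_add x, pow_add y, pow_mul, pow_mul]
    ring
  simp_rw [e, Finset.sum_mul_sum, Finset.mul_sum]
  symm
  rw [Finset.sum_congr rfl fun y _ => Finset.sum_comm, Finset.sum_comm]
  refine Finset.sum_congr rfl fun j _ => ?_
  rw [Finset.sum_congr rfl fun y _ => Finset.sum_comm, Finset.sum_comm]
  exact Finset.sum_congr rfl fun i _ => Finset.sum_comm

end InjectiveDifferences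

/-! ### Prime fields -/

theorem Nat.Prime.not_dvd_choose_of_lt {p a b : ℕ} (hp : p.Prime) (hba : b ≤ a) (hap : a < p) :
    ¬ p ∣ a.choose b := fun h => by
  have h1 := Nat.choose_mul_factorial_mul_factorial hba ▸
    (h.mul_right b.factorial).mul_right (a - b).factorial
  exact absurd (hp.dvd_factorial.mp h1) (by omega)

/-- A planar monomial over a field of odd prime order is congruent to `x ^ 2`. -/
theorem InjectiveDifferences.modEq_two {p : ℕ} [Fact p.Prime] {n : ℕ}
    (h : InjectiveDifferences (ZMod p) n) (hp : p ≠ 2) : n ≡ 2 [MOD p - 1] := by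
  have hp2 := (Fact.out : p.Prime).two_le
  obtain ⟨N, hN⟩ := (Fact.out : p.Prime).odd_of_ne_two hp
  obtain ⟨ν, hν⟩ := h.even
  have hpN : p - 1 = 2 * N := by omega
  have h2 : (2 : ZMod p) ≠ 0 := by
    intro h0
    have := (ZMod.natCast_eq_zero_iff 2 p).mp (by exact_mod_cast h0)
    exact hp ((Nat.prime_dvd_prime_iff_eq Fact.out Nat.prime_two).mp this)
  rw [← two_mul] at hν
  rw [hpN, hν, show 2 = 2 * 1 from rfl, mul_assoc, one_mul]
  refine Nat.ModEq.mul_left' 2 ?_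
  have hcop : ν.Coprime N := by
    have := h.gcd_dvd_two h2
    rw [ZMod.card, hpN, hν, Nat.gcd_mul_left] at this
    exact Nat.dvd_one.mp (Nat.dvd_of_mul_dvd_mul_left two_pos this)
  rcases Nat.lt_or_ge N 2 with hN1 | hN2
  · obtain rfl : N = 1 := by omega
    exact Nat.modEq_one
  obtain ⟨v, hvN, hv⟩ := Nat.exists_mul_mod_eq_one_of_coprime hcop hN2
  have hvmod : ν * v ≡ 1 [MOD N] := by rw [Nat.ModEq, hv, Nat.mod_eq_of_lt hN2]
  rcases Nat.lt_or_ge v 2 with hv1 | hv2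
  · interval_cases v
    · simp at hv
    · simpa using hvmod
  exfalso
  -- Dividing `N - 1` instead of `N` puts the remainder `j₀` in 1, ..., `v`.
  obtain ⟨m, j₀, hm, hj₀, hj₀v, hsum⟩ : ∃ m j₀, 0 < m ∧ 0 < j₀ ∧ j₀ ≤ v ∧ j₀ + v * m = N := by
    have h1 := Nat.div_add_mod (N - 1) v
    have h2 := Nat.mod_lt (N - 1) (show 0 < v by omega)
    refine ⟨(N - 1) / v, (N - 1) % v + 1, Nat.div_pos (by omega) (by omega), by omega, by omega,
      by omega⟩
  have hvm : 2 * m ≤ v * m := Nat.mul_le_mul_right m hv2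
  have hlow : ∀ l, N ∣ l → v * l = N → False := by
    intro l hl hvl
    rcases Nat.eq_zero_or_pos l with rfl | hl0
    · omega
    · have := Nat.le_of_dvd hl0 hl
      nlinarith
  have hzero := h.sum_choose_mul_choose_eq_zero (s := 4 * m) (k := 2 * j₀) (by omega)
    (by rw [ZMod.card]; omega)
  simp only [FiniteField.sum_pow_eq, ZMod.card, hpN, hν] at hzero
  -- With i = 2l, multiplying by `v` gives N ∣ vl + j ≤ 2N. The values 0 and 2N make one exponent
  -- zero. For the value N, l ≠ m forces j to an end of its range, which `hlow` excludes.
  have huniq : ∀ j ≤ 2 * j₀, ∀ i ≤ 4 * m, 0 < i + 2 * ν * j → 2 * N ∣ i + 2 * ν * j →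
      0 < 4 * m - i + 2 * ν * (2 * j₀ - j) → 2 * N ∣ 4 * m - i + 2 * ν * (2 * j₀ - j) →
      j = j₀ ∧ i = 2 * m := by
    intro j hj i hi hpos hdvd hpos' hdvd'
    have h2i : 2 ∣ i := by
      have := (Nat.dvd_mul_right 2 N).trans hdvd
      rwa [mul_assoc, Nat.dvd_add_left (Nat.dvd_mul_right 2 _)] at this
    obtain ⟨l, rfl⟩ := h2i
    have hd : ∀ l j, 2 * N ∣ 2 * l + 2 * ν * j → N ∣ v * l + j := by
      intro l j hlj
      rw [mul_assoc, ← mul_add] at hlj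
      have h1 := Nat.dvd_of_mul_dvd_mul_left two_pos hlj
      have h2 : v * (l + ν * j) ≡ v * l + j [MOD N] := by
        calc v * (l + ν * j) = v * l + ν * v * j := by ring
          _ ≡ v * l + 1 * j [MOD N] := (hvmod.mul_right j).add_left _
          _ = v * l + j := by ring
      exact (h2.dvd_iff dvd_rfl).mp (h1.mul_left v)
    obtain ⟨c, hc⟩ := hd l j hdvd
    have hlm : l ≤ 2 * m := by omega
    have hvl : v * l ≤ v * (2 * m) := Nat.mul_le_mul_left v hlm
    have hvl2 : v * (2 * m) = 2 * (v * m) := by ring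
    have hc2 : c ≤ 2 := by
      by_contra hc3
      have : N * 3 ≤ N * c := Nat.mul_le_mul_left N (by omega)
      omega
    have hl_of : ∀ l l', v * l = v * l' → l = l' := fun l l' hl =>
      Nat.eq_of_mul_eq_mul_left (by omega) hl
    interval_cases c
    · have hl0 : l = 0 := hl_of l 0 (by omega)
      have hj0 : j = 0 := by omega
      simp [hl0, hj0] at hpos
    · rcases lt_trichotomy l m with hlt | rfl | hgt
      · have h1 : v * (l + 1) ≤ v * m := Nat.mul_le_mul_left v hlt
        rw [mul_add] at h1
        have hj : j = 2 * j₀ := by omega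
        rw [hj, Nat.sub_self, mul_zero, add_zero, show 4 * m - 2 * l = 2 * (2 * m - l) by omega]
          at hdvd'
        refine (hlow _ (Nat.dvd_of_mul_dvd_mul_left two_pos hdvd') ?_).elim
        rw [Nat.mul_sub]
        omega
      · omega
      · have h1 : v * (m + 1) ≤ v * l := Nat.mul_le_mul_left v hgt
        rw [mul_add] at h1
        have hj : j = 0 := by omega
        rw [hj, mul_zero, add_zero] at hdvd
        exact (hlow l (Nat.dvd_of_mul_dvd_mul_left two_pos hdvd) (by omega)).elim
    · have hl0 : l = 2 * m := hl_of _ _ (by omega)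
      have hj0 : j = 2 * j₀ := by omega
      rw [hl0, hj0] at hpos'
      simp at hpos'
      omega
  have hdvd₀ : 2 * N ∣ 2 * m + 2 * ν * j₀ := by
    rw [mul_assoc, ← mul_add]
    refine mul_dvd_mul_left 2 ?_
    have h1 : ν * j₀ + ν * v * m = N * ν := by rw [← hsum]; ring
    have h2 : ν * j₀ + ν * v * m ≡ ν * j₀ + 1 * m [MOD N] := (hvmod.mul_right m).add_left _
    rw [h1, one_mul, add_comm] at h2
    exact (h2.dvd_iff dvd_rfl).mp (Nat.dvd_mul_right N ν)
  have hpos₀ : 0 < 2 * m + 2 * ν * j₀ := by omega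
  rw [Finset.sum_eq_single_of_mem j₀ (Finset.mem_range.mpr (by omega)),
    Finset.sum_eq_single_of_mem (2 * m) (Finset.mem_range.mpr (by omega))] at hzero
  · rw [show 4 * m - 2 * m = 2 * m by omega, show 2 * j₀ - j₀ = j₀ by omega,
      if_pos ⟨hpos₀, hdvd₀⟩] at hzero
    have hchoose : ∀ a b : ℕ, b ≤ a → a < p → ((a.choose b : ℕ) : ZMod p) ≠ 0 := by
      intro a b hb ha
      rw [Ne, ZMod.natCast_eq_zero_iff]
      exact (Fact.out : p.Prime).not_dvd_choose_of_lt hb ha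
    have h1 := hchoose (4 * m) (2 * m) (by omega) (by omega)
    have h2 := hchoose (2 * j₀) j₀ (by omega) (by omega)
    simp [h1, h2] at hzero
  · intro i hi hne
    rw [mul_eq_zero, ite_and, ite_and]
    right
    by_contra hcon
    simp only [mul_eq_zero, not_or, ite_eq_right_iff, Classical.not_imp] at hcon
    obtain ⟨⟨h1, h2, -⟩, h3, h4, -⟩ := hcon
    exact hne (huniq j₀ (by omega) i (by simpa [Nat.lt_succ_iff] using hi) h1 h2 h3 h4).2
  · intro j hj hne
    refine Finset.sum_eq_zero fun i hi => ?_
    rw [mul_eq_zero, ite_and, ite_and]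
    right
    by_contra hcon
    simp only [mul_eq_zero, not_or, ite_eq_right_iff, Classical.not_imp] at hcon
    obtain ⟨⟨h1, h2, -⟩, h3, h4, -⟩ := hcon
    exact hne (huniq j (by simpa [Nat.lt_succ_iff] using hj) i
      (by simpa [Nat.lt_succ_iff] using hi) h1 h2 h3 h4).1

/-! ### Algebraic degree of monomial functions -/

theorem digitSum_eq_of_lt_sq {p e : ℕ} (hp : 1 < p) (he : e < p ^ 2) :
    digitSum p e = e % p + e / p := by
  have hlt : e / p < p := Nat.div_lt_of_lt_mul (by rwa [← sq])
  rw [digitSum]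
  rcases Nat.eq_zero_or_pos e with rfl | he0
  · simp
  rw [Nat.digits_def' hp he0]
  rcases Nat.eq_zero_or_pos (e / p) with h0 | h0
  · simp [h0]
  · rw [Nat.digits_of_lt p _ h0.ne' hlt]
    simp

open Polynomial in
theorem interpolatingPolynomial_pow {K : Type*} [Field K] [Fintype K] {e : ℕ}
    (he : e < Fintype.card K) : interpolatingPolynomial (fun x : K => x ^ e) = X ^ e := by
  classical
  rw [interpolatingPolynomial]
  symm
  convert Lagrange.eq_interpolate_of_eval_eq (s := Finset.univ) (v := (id : K → K)) (f := X ^ e)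
    (fun x : K => x ^ e) Function.injective_id.injOn ?_ ?_
  · rw [degree_X_pow]
    exact_mod_cast he
  · simp

open Polynomial in
theorem algebraicDegree_pow {p : ℕ} {K : Type*} [Field K] [Fintype K] {e : ℕ}
    (he : e < Fintype.card K) : algebraicDegree p (fun x : K => x ^ e) = digitSum p e := by
  rw [algebraicDegree, interpolatingPolynomial_pow he, support_X_pow, Finset.sup_singleton]

/-- Every monomial function with positive exponent has an exponent between `1` and `q - 1`. -/
theorem exists_pow_eq_pow_of_pos (K : Type*) [Field K] [Fintype K] {d : ℕ} (hd : 0 < d) :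
    ∃ e, 0 < e ∧ e < Fintype.card K ∧ (fun x : K => x ^ d) = fun x => x ^ e := by
  have hq : 0 < Fintype.card K - 1 := Nat.sub_pos_of_lt Fintype.one_lt_card
  have hlt := Nat.mod_lt (d - 1) hq
  refine ⟨(d - 1) % (Fintype.card K - 1) + 1, by omega, by omega, funext fun x => ?_⟩
  rcases eq_or_ne x 0 with rfl | hx
  · simp [hd.ne']
  · have h1 := Nat.div_add_mod (d - 1) (Fintype.card K - 1)
    have h2 : d = (Fintype.card K - 1) * ((d - 1) / (Fintype.card K - 1)) +
        ((d - 1) % (Fintype.card K - 1) + 1) := by omega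
    conv_lhs => rw [h2]
    rw [pow_add, pow_mul, FiniteField.pow_card_sub_one_eq_one x hx, one_pow, one_mul]

/-! ### Excluding digit sum p + 1 -/

theorem Nat.Prime.dvd_choose_add_one {p j : ℕ} (hp : p.Prime) (h2 : 2 ≤ j) (hj : j < p) :
    p ∣ (p + 1).choose j := by
  obtain ⟨i, rfl⟩ : ∃ i, j = i + 1 := ⟨j - 1, by omega⟩
  rw [Nat.choose_succ_succ]
  exact dvd_add (hp.dvd_choose_self (by omega) (by omega)) (hp.dvd_choose_self (by omega) hj)

/-- Over a field of order `p ^ 2`, an exponent whose two base-`p` digits are at least `2` and sum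
to `p + 1` is not planar. -/
theorem InjectiveDifferences.false_of_digits {p : ℕ} [Fact p.Prime] {K : Type*} [Field K]
    [Fintype K] [CharP K p] (hK : Fintype.card K = p ^ 2) {a b : ℕ} (hab : a + b + 3 = p)
    (hpos : 0 < a + b) (h : InjectiveDifferences K (a + 2 + (b + 2) * p)) : False := by
  have hp : p.Prime := Fact.out
  have hp2 : p ≠ 2 := by omega
  have hpodd : Odd p := hp.odd_of_ne_two hp2
  obtain ⟨n, hn⟩ : ∃ n, n = a + 2 + (b + 2) * p := ⟨_, rfl⟩
  -- `A` and `B` represent -n and -np modulo `Q`; their digits are swapped.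
  obtain ⟨A, hA⟩ : ∃ A, A = b + a * p := ⟨_, rfl⟩
  obtain ⟨B, hB⟩ : ∃ B, B = a + b * p := ⟨_, rfl⟩
  obtain ⟨Q, hQ⟩ : ∃ Q, Q = Fintype.card K - 1 := ⟨_, rfl⟩
  have hQp : Q + 1 = p ^ 2 := by have := Fintype.card_pos (α := K); omega
  rw [← hn] at h
  have hnA : n + A = Q := by
    have : n + A + 1 = p ^ 2 := by rw [hn, hA, ← hab]; ring
    omega
  have hnB : n * p + B = Q * (b + 3) := by
    have : n * p + B + (b + 3) = (Q + 1) * (b + 3) := by rw [hQp, hn, hB, ← hab]; ring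
    rw [add_mul] at this
    omega
  have hs0 : 0 < A + B := by
    have : a ≤ a * p := Nat.le_mul_of_pos_right a hp.pos
    omega
  have hsQ : A + B < Q := by
    have : A + B + 2 * (p + 1) = Q := by
      have : A + B + 2 * (p + 1) + 1 = p ^ 2 := by rw [hA, hB, ← hab]; ring
      omega
    omega
  have hn0 : 0 < n := h.pos
  have hpQ : p + 1 < Q := by
    have : p * 3 ≤ p * p := Nat.mul_le_mul_left p (by omega)
    rw [sq] at hQp
    have := hp.two_le
    omega
  have hzero := h.sum_choose_mul_choose_eq_zero (s := A + B) (k := p + 1) hs0 (hQ ▸ hpQ)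
  simp only [FiniteField.sum_pow_eq, ← hQ] at hzero
  have hmul : ∀ x : ℕ, 0 < x → x < 2 * Q → Q ∣ x → x = Q := by
    rintro x hx0 hx2 ⟨c, rfl⟩
    have h1 : 0 < c := Nat.pos_of_mul_pos_left hx0
    have h2 : c < 2 := by
      by_contra hc
      have := Nat.mul_le_mul_left Q (show 2 ≤ c by omega)
      omega
    rw [show c = 1 by omega, mul_one]
  -- Lucas: both digits of `A + B` are a + b < p, so no carry occurs.
  have hchoose : ((A + B).choose A : K) ≠ 0 := by
    rw [Ne, CharP.cast_eq_zero_iff K p]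
    have hl := Choose.choose_modEq_choose_mod_mul_choose_div_nat (n := A + B) (k := A) (p := p)
    have e1 : A + B = (a + b) + (a + b) * p := by rw [hA, hB]; ring
    have hdiv : ∀ x y : ℕ, x < p → (x + y * p) % p = x ∧ (x + y * p) / p = y := fun x y hx =>
      ⟨by rw [Nat.add_mul_mod_self_right, Nat.mod_eq_of_lt hx],
        by rw [Nat.add_mul_div_right _ _ hp.pos, Nat.div_eq_of_lt hx, zero_add]⟩
    rw [e1, hA, (hdiv (a + b) (a + b) (by omega)).1, (hdiv (a + b) (a + b) (by omega)).2,
      (hdiv b a (by omega)).1, (hdiv b a (by omega)).2, ← e1, ← hA] at hl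
    rw [hl.dvd_iff dvd_rfl, hp.dvd_mul, not_or]
    exact ⟨hp.not_dvd_choose_of_lt (by omega) (by omega),
      hp.not_dvd_choose_of_lt (by omega) (by omega)⟩
  -- Modulo p, `(p + 1).choose j` vanishes for 2 ≤ j < p; for j = 0 and j = p + 1 one exponent is at
  -- most `A + B < Q`.
  rw [Finset.sum_eq_add_of_mem 1 p (Finset.mem_range.mpr (by omega))
    (Finset.mem_range.mpr (by omega)) (by omega)] at hzero
  · rw [Finset.sum_eq_single_of_mem A (Finset.mem_range.mpr (by omega)),
      Finset.sum_eq_single_of_mem B (Finset.mem_range.mpr (by omega))] at hzero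
    · have hsymm : (A + B).choose B = (A + B).choose A := Nat.choose_symm_add.symm
      have hpar : Even (A + B) := by
        have e1 : A + B = (a + b) * (p + 1) := by rw [hA, hB]; ring
        rw [e1]
        exact hpodd.add_one.mul_left _
      have hBA : (-1 : K) ^ B = (-1) ^ A := by
        have h1 : (-1 : K) ^ (A + B) = 1 := hpar.neg_one_pow
        have h2 : (-1 : K) ^ A * (-1) ^ A = 1 := by rw [← mul_pow]; simp
        rw [pow_add] at h1
        linear_combination (-1 : K) ^ A * h1 - (-1) ^ B * h2
      have c1 : 0 < A + n * 1 ∧ Q ∣ A + n * 1 := ⟨by omega, by rw [mul_one, add_comm, hnA]⟩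
      have c2 : 0 < A + B - A + n * (p + 1 - 1) ∧ Q ∣ A + B - A + n * (p + 1 - 1) := by
        rw [Nat.add_sub_cancel_left, Nat.add_sub_cancel, add_comm, hnB]
        exact ⟨Nat.mul_pos (by omega) (by omega), Nat.dvd_mul_right _ _⟩
      have c3 : 0 < B + n * p ∧ Q ∣ B + n * p := by
        rw [add_comm, hnB]
        exact ⟨Nat.mul_pos (by omega) (by omega), Nat.dvd_mul_right _ _⟩
      have c4 : 0 < A + B - B + n * (p + 1 - p) ∧ Q ∣ A + B - B + n * (p + 1 - p) := by
        rw [Nat.add_sub_cancel, Nat.add_sub_cancel_left, mul_one, add_comm, hnA]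
        exact ⟨by omega, dvd_rfl⟩
      rw [if_pos c1, if_pos c2, if_pos c3, if_pos c4, hsymm, Nat.choose_one_right,
        Nat.choose_succ_self_right, pow_add _ A, pow_add _ B, hBA, hpar.neg_one_pow,
        show 1 + (p + 1) = p + 2 by ring, show p + (p + 1) = p + p + 1 by ring, pow_succ, pow_add,
        pow_add, hpodd.neg_one_pow] at hzero
      have h2 : (2 : K) ≠ 0 := by
        intro h0
        have := (CharP.cast_eq_zero_iff K p 2).mp (by exact_mod_cast h0)
        exact hp2 ((Nat.prime_dvd_prime_iff_eq hp Nat.prime_two).mp this)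
      push_cast [CharP.cast_eq_zero K p] at hzero
      rw [(Even.add_self p).neg_one_pow] at hzero
      -- The two surviving terms are equal, signs included, so they add up.
      have h3 : (2 : K) * ((-1) ^ A * ((A + B).choose A : K)) = 0 := by
        linear_combination -hzero
      simp [h2, hchoose] at h3
    all_goals
      intro i hi hne
      rw [Finset.mem_range] at hi
      rw [mul_eq_zero, ite_and, ite_and]
      right
      by_contra hcon
      simp only [mul_eq_zero, not_or, ite_eq_right_iff, Classical.not_imp] at hcon
      obtain ⟨⟨h1, h2, -⟩, h3, h4, -⟩ := hcon
    · rw [Nat.add_sub_cancel_left, mul_one] at h3 h4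
      have := hmul _ h3 (by omega) h4
      omega
    · rw [mul_one] at h1 h2
      have := hmul _ h1 (by omega) h2
      omega
  · intro j hj hne
    rw [Finset.mem_range] at hj
    refine Finset.sum_eq_zero fun i hi => ?_
    rw [Finset.mem_range] at hi
    by_cases hmid : 2 ≤ j ∧ j < p
    · rw [(CharP.cast_eq_zero_iff K p _).mpr (hp.dvd_choose_add_one hmid.1 hmid.2)]
      simp
    rw [mul_eq_zero, ite_and, ite_and]
    right
    by_contra hcon
    simp only [mul_eq_zero, not_or, ite_eq_right_iff, Classical.not_imp] at hcon
    obtain ⟨⟨h1, h2, -⟩, h3, h4, -⟩ := hcon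
    obtain rfl | rfl : j = 0 ∨ j = p + 1 := by omega
    · rw [mul_zero, add_zero] at h1 h2
      have := Nat.le_of_dvd h1 h2
      omega
    · rw [Nat.sub_self, mul_zero, add_zero] at h3 h4
      have := Nat.le_of_dvd h3 h4
      omega

/-! ### Conclusion -/

theorem mainTheorem6 (p : ℕ) (hp : p.Prime) (K : Type*) [Field K] [Fintype K]
    (hK : Fintype.card K = p ^ 2) (F : K → K) (hmon : IsMonomialFunction F)
    (hplanar : IsPlanar F) : algebraicDegree p F = 2 := by
  obtain ⟨d, rfl⟩ := hmon
  have : Fact p.Prime := ⟨hp⟩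
  have : CharP K p := charP_of_card_eq_prime_pow hK
  have h2 := hplanar.two_ne_zero
  have hp2 : p ≠ 2 := by
    rintro rfl
    exact h2 (by exact_mod_cast CharP.cast_eq_zero K 2)
  have hp3 : 3 ≤ p := by have := hp.two_le; omega
  obtain ⟨e, he0, heK, he⟩ := exists_pow_eq_pow_of_pos K hplanar.injectiveDifferences.pos
  rw [he] at hplanar ⊢
  have h := hplanar.injectiveDifferences
  rw [algebraicDegree_pow heK, digitSum_eq_of_lt_sq hp.one_lt (hK ▸ heK)]
  let : Algebra (ZMod p) K := ZMod.algebra K p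
  have hmod := (h.of_algebraMap (k := ZMod p)).modEq_two hp2
  have hgcd := h.gcd_dvd_two h2
  rw [hK] at hgcd heK
  have hdm := Nat.mod_add_div e p
  have ha := Nat.mod_lt e hp.pos
  have hb : e / p < p := Nat.div_lt_of_lt_mul (by rwa [← sq])
  generalize e % p = a at *
  generalize e / p = b at *
  subst hdm
  have hab : a + b ≡ 2 [MOD p - 1] := by
    refine Nat.ModEq.trans ?_ hmod
    have h1 : p ≡ 1 [MOD p - 1] :=
      ((Nat.modEq_iff_dvd' hp.one_lt.le).mpr dvd_rfl).symm
    simpa using ((h1.mul_right b).add_left a).symm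
  have hpos : 0 < a + b := by
    rcases Nat.eq_zero_or_pos b with rfl | hb0
    · simpa using he0
    · omega
  have hne : a + b ≠ 2 * (p - 1) := by
    intro h0
    obtain rfl : a = p - 1 := by omega
    obtain rfl : b = p - 1 := by omega
    have h1 : p - 1 + p * (p - 1) = p ^ 2 - 1 := by
      rw [Nat.mul_sub, mul_one, ← sq]
      have : p ≤ p ^ 2 := Nat.le_self_pow two_ne_zero p
      omega
    rw [h1, Nat.gcd_self] at hgcd
    have := Nat.le_of_dvd two_pos hgcd
    have : 3 ^ 2 ≤ p ^ 2 := Nat.pow_le_pow_left hp3 2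
    omega
  by_contra hsum
  have hcase : a + b = p + 1 := by
    rcases Nat.lt_or_ge (a + b) 2 with hlt | hge
    · have := (Nat.modEq_iff_dvd' hlt.le).mp hab
      have := Nat.le_of_dvd (by omega) this
      omega
    · obtain ⟨c, hc⟩ := (Nat.modEq_iff_dvd' hge).mp hab.symm
      have hc0 : c ≠ 0 := by rintro rfl; omega
      have hc2 : c < 2 := by
        by_contra hc3
        have := Nat.mul_le_mul_left (p - 1) (show 2 ≤ c by omega)
        omega
      rw [show c = 1 by omega] at hc
      omega
  -- Both digits are below p and sum to p + 1, so each is at least 2.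
  obtain ⟨a', rfl⟩ : ∃ a', a = a' + 2 := ⟨a - 2, by omega⟩
  obtain ⟨b', rfl⟩ : ∃ b', b = b' + 2 := ⟨b - 2, by omega⟩
  rw [mul_comm p] at h
  exact h.false_of_digits hK (by omega) (by omega)
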